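/- For $t>0$ let $w(x,t)=e^{-x^2-t/x^2}$, $x\in\mathbb{R}$. Let $P_n(x)=P_n(x,t)$, $n=0,1,2,\ldots$, be the monic polynomials with $\deg P_n=n$ that are orthogonal with respect to $w(\cdot,t)$ on $\mathbb{R}$, and let $h_n(t)=\int_{-\infty}^{\infty}P_n(x,t)^2w(x,t)\,dx$. These exist and $h_n(t)>0$. For $n\ge 0$ put $$R_n(t)=\frac{2t}{h_n(t)}\int_{-\infty}^{\infty}\frac{P_n(y)^2}{y^2}\,w(y,t)\,dy,$$ and put $$r_n(t)=\frac{2t}{h_{n-1}(t)}\int_{-\infty}^{\infty}\frac{P_n(y)P_{n-1}(y)}{y^3}\,w(y,t)\,dy\quad(n\ge1),\qquad r_0(t)=0 .$$ All these integrals converge. Then, for every integer $n\ge0$, $R_n$ and $r_n$ are twice differentiable on $(0,\infty)$, $R_n$ has no zero there, and the following hold for all $t>0$. (i) $R_n$ satisfies $$R_n''=\frac{(R_n')^2}{R_n}-\frac{R_n'}{t}+\frac{(2n+1)R_n^2}{4t^2}-\frac{(-1)^n}{t}+\frac{R_n^3}{4t^2}-\frac{4}{R_n},$$ that is, $R_n$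 solves $P_{\mathrm{III}'}(\alpha,\beta,\gamma,\delta)$: $$q''=\frac{(q')^2}{q}-\frac{q'}{t}+\frac{\alpha q^2}{4t^2}+\frac{\beta}{4t}+\frac{\gamma q^3}{4t^2}+\frac{\delta}{4q}$$ with $(\alpha,\beta,\gamma,\delta)=(2n+1,\,-4(-1)^n,\,1,\,-16)$. (ii) $r_n$ satisfies $$\Big[2t^2r_n'r_n''+2t\,r_n(r_n')^2-8(-1)^nt\,r_nr_n'+t(r_n')^2-4(-1)^nnt\,r_n'-8(-1)^nr_n^3-8(-1)^nn\,r_n^2\Big]^2$$ $$=t\Big[t(r_n')^2-4(-1)^nr_n^2-4(-1)^nn\,r_n\Big]\Big[2t\,r_n''+2r_nr_n'+r_n'-8(-1)^nr_n-4(-1)^nn\Big]^2 .$$ (iii) $r_n$ and $R_n$ satisfy the coupled first-order system $$r_n'=-\frac{2(-1)^nr_n}{R_n}-\frac{n+r_n}{2t}R_n,\qquad 2tR_n'=R_n^2+(1-2r_n)R_n-4(-1)^nt .$$ -/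

import Mathlib

open MeasureTheory Polynomial

noncomputable section

namespace SingularGaussian

/-- The weight `w(x,t) = exp (-x^2 - t/x^2)`. Its value at the single point `x = 0` is irrelevant,
since it is only used under integrals with respect to Lebesgue measure. -/
def weight (x t : ℝ) : ℝ := Real.exp (-x ^ 2 - t / x ^ 2)

/-- The bilinear form `∫ p(x) q(x) w(x,t) dx` on real polynomials. -/
def pairing (t : ℝ) (p q : ℝ[X]) : ℝ := ∫ x : ℝ, p.eval x * q.eval x * weight x t

/-- The monic orthogonal polynomials `P_n(x,t)`, by the Gram-Schmidt process applied to
`1, x, x^2, …`. -/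
def P (t : ℝ) : ℕ → ℝ[X]
  | n => X ^ n - ∑ k : Fin n,
      C (pairing t (X ^ n) (P t k) / pairing t (P t k) (P t k)) * P t k
decreasing_by exact k.2

/-- `Q_0, Q_1, …` are the monic polynomials, `Q_n` of degree `n`, orthogonal with respect to
`w(·,t)`; the integrals converge and the squared norms are positive. -/
def IsMonicOrthogonal (t : ℝ) (Q : ℕ → ℝ[X]) : Prop :=
  (∀ n, (Q n).Monic ∧ (Q n).natDegree = n) ∧
  (∀ m n, Integrable (fun x : ℝ => (Q m).eval x * (Q n).eval x * weight x t)) ∧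
  (∀ m n, m ≠ n → pairing t (Q m) (Q n) = 0) ∧
  (∀ n, 0 < pairing t (Q n) (Q n))

/-- The squared norm `h_n(t) = ∫ P_n(x,t)^2 w(x,t) dx`. -/
def h (n : ℕ) (t : ℝ) : ℝ := pairing t (P t n) (P t n)

/-- `R_n(t) = (2t / h_n) ∫ y^(-2) P_n(y)^2 w(y) dy`. -/
def R (n : ℕ) (t : ℝ) : ℝ :=
  2 * t / h n t * ∫ y : ℝ, 1 / y ^ 2 * (P t n).eval y ^ 2 * weight y t

/-- `r_n(t) = (2t / h_(n-1)) ∫ y^(-3) P_n(y) P_(n-1)(y) w(y) dy` for `n ≥ 1`, and `r_0 = 0`. -/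
def r : ℕ → ℝ → ℝ
  | 0, _ => 0
  | n + 1, t =>
      2 * t / h n t * ∫ y : ℝ, 1 / y ^ 3 * (P t (n + 1)).eval y * (P t n).eval y * weight y t

/-- `q` is twice differentiable at every point of `(0, ∞)`. -/
def TwiceDifferentiable (q : ℝ → ℝ) : Prop :=
  ∀ t : ℝ, 0 < t → DifferentiableAt ℝ q t ∧ DifferentiableAt ℝ (deriv q) t

/-- `q` is a nowhere vanishing, twice differentiable solution on `(0, ∞)` of the Painlevé III'
equation with parameters `α, β, γ, δ`. -/
def SolvesPIII' (α β γ δ : ℝ) (q : ℝ → ℝ) : Prop :=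
  TwiceDifferentiable q ∧ ∀ t : ℝ, 0 < t → q t ≠ 0 ∧
    deriv (deriv q) t = (deriv q t) ^ 2 / q t - deriv q t / t + α * q t ^ 2 / (4 * t ^ 2)
      + β / (4 * t) + γ * q t ^ 3 / (4 * t ^ 2) + δ / (4 * q t)

end SingularGaussian

end

noncomputable section

namespace SingularGaussian

/-! Write `β_n = h_n / h_(n-1)`, the recurrence coefficient. Everything follows from three
identities at fixed `t` and one derivative in `t`. The recurrence applied under the integral gives
`R_n = r_n + r_(n+1)` (`R_eq_r_add_r`). Integration by parts gives `2 β_n = n + r_n`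
(`two_mul_h_succ_div`). Parity makes one of two consecutive polynomials divisible by `x`, which
yields `β_(n+1) R_(n+1) R_n = 2 (-1)^n t r_(n+1)` (`h_div_mul_R_mul_R`). Since `P_n` minimizes the
norm, differentiating `h_n` sees only the weight, so `h_n' = -h_n R_n / (2t)` (`hasDerivAt_h`).
Differentiating `β_n` gives `r_n'` in terms of `R_n` and `R_(n-1)`; the product identity removes the
shifted index and produces the coupled system. The second order equations are eliminations from that
system. -/

/-! ### Moments of the weight with negative powers -/

/-- The functional `p ↦ ∫ p(x) x^(-m) w(x,t) dx` on real polynomials. -/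
def invMoment (t : ℝ) (m : ℕ) (p : ℝ[X]) : ℝ := ∫ x : ℝ, p.eval x * x⁻¹ ^ m * weight x t

theorem weight_pos (x t : ℝ) : 0 < weight x t := Real.exp_pos _

theorem measurable_weight (t : ℝ) : Measurable fun x => weight x t := by
  unfold weight; fun_prop

theorem weight_neg (x t : ℝ) : weight (-x) t = weight x t := by simp [weight]

theorem aestronglyMeasurable_mul_weight (t : ℝ) (m : ℕ) (p : ℝ[X]) :
    AEStronglyMeasurable fun x : ℝ => p.eval x * x⁻¹ ^ m * weight x t := by
  have := measurable_weight t
  have h2 : Measurable fun x : ℝ => p.eval x := p.continuous.measurable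
  exact ((h2.mul (by fun_prop)).mul this).aestronglyMeasurable

theorem integrable_pow_mul_exp_neg_sq (k : ℕ) :
    Integrable fun x : ℝ => x ^ k * Real.exp (-x ^ 2) := by
  have := integrable_rpow_mul_exp_neg_mul_sq (b := 1) one_pos (s := k)
    (by have : (0 : ℝ) ≤ k := k.cast_nonneg
        linarith)
  simpa using this

/-- Keeping a single term of the series of `exp (t / x^2)` trades the pole `|x|^(-m)` for the growth
`|x|^m`, which the Gaussian factor absorbs. -/
theorem inv_pow_mul_weight_le {t : ℝ} (ht : 0 < t) (m : ℕ) (x : ℝ) :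
    |x⁻¹ ^ m| * weight x t ≤ m.factorial / t ^ m * (|x| ^ m * Real.exp (-x ^ 2)) := by
  rcases eq_or_ne x 0 with rfl | hx
  · rcases Nat.eq_zero_or_pos m with rfl | hm
    · simp [weight]
    · simp [hm.ne']
  have h1 := Real.pow_div_factorial_le_exp (t / x ^ 2) (by positivity) m
  have h2 : weight x t = Real.exp (-x ^ 2) * (Real.exp (t / x ^ 2))⁻¹ := by
    rw [← Real.exp_neg, ← Real.exp_add, weight]; ring_nf
  have h3 : (Real.exp (t / x ^ 2))⁻¹ ≤ ((t / x ^ 2) ^ m / m.factorial)⁻¹ :=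
    inv_anti₀ (by positivity) h1
  have hx' : 0 < |x| := abs_pos.2 hx
  calc |x⁻¹ ^ m| * weight x t
      ≤ |x⁻¹ ^ m| * (Real.exp (-x ^ 2) * ((t / x ^ 2) ^ m / m.factorial)⁻¹) := by
        rw [h2]; gcongr
    _ = m.factorial / t ^ m * (|x| ^ m * Real.exp (-x ^ 2)) := by
        rw [abs_pow, abs_inv, ← sq_abs x, div_pow, inv_pow, ← pow_mul, pow_mul']
        field_simp

theorem integrable_mul_weight {t : ℝ} (ht : 0 < t) (m : ℕ) (p : ℝ[X]) :
    Integrable fun x : ℝ => p.eval x * x⁻¹ ^ m * weight x t := by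
  induction p using Polynomial.induction_on' with
  | add p q hp hq =>
    refine (hp.add hq).congr (.of_forall fun x => ?_)
    simp only [Pi.add_apply, eval_add]; ring
  | monomial k a =>
    refine Integrable.mono' ((integrable_pow_mul_exp_neg_sq (k + m)).norm.const_mul
      (|a| * (m.factorial / t ^ m))) (aestronglyMeasurable_mul_weight _ _ _) (.of_forall fun x => ?_)
    have := inv_pow_mul_weight_le ht m x
    simp only [eval_monomial, Real.norm_eq_abs, abs_mul, abs_of_pos (weight_pos x t),
      abs_of_pos (Real.exp_pos _)]
    calc |a| * |x ^ k| * |x⁻¹ ^ m| * weight x t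
        = |a| * |x ^ k| * (|x⁻¹ ^ m| * weight x t) := by ring
      _ ≤ |a| * |x ^ k| * (m.factorial / t ^ m * (|x| ^ m * Real.exp (-x ^ 2))) := by gcongr
      _ = _ := by rw [abs_pow, abs_pow, pow_add]; ring

theorem invMoment_add {t : ℝ} (ht : 0 < t) (m : ℕ) (p q : ℝ[X]) :
    invMoment t m (p + q) = invMoment t m p + invMoment t m q := by
  rw [invMoment, invMoment, invMoment,
    ← integral_add (integrable_mul_weight ht m p) (integrable_mul_weight ht m q)]
  simp only [eval_add, add_mul]

theorem invMoment_sub {t : ℝ} (ht : 0 < t) (m : ℕ) (p q : ℝ[X]) :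
    invMoment t m (p - q) = invMoment t m p - invMoment t m q := by
  rw [invMoment, invMoment, invMoment,
    ← integral_sub (integrable_mul_weight ht m p) (integrable_mul_weight ht m q)]
  simp only [eval_sub, sub_mul]

theorem invMoment_sum {t : ℝ} (ht : 0 < t) (m : ℕ) {ι : Type*} (s : Finset ι) (f : ι → ℝ[X]) :
    invMoment t m (∑ i ∈ s, f i) = ∑ i ∈ s, invMoment t m (f i) := by
  simp only [invMoment]
  rw [← integral_finsetSum _ fun i _ => integrable_mul_weight ht m (f i)]
  simp only [eval_finsetSum, Finset.sum_mul]

theorem invMoment_C_mul (t : ℝ) (m : ℕ) (a : ℝ) (p : ℝ[X]) :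
    invMoment t m (C a * p) = a * invMoment t m p := by
  simp only [invMoment, eval_mul, eval_C, mul_assoc, integral_const_mul]

theorem invMoment_succ_X_mul (t : ℝ) (m : ℕ) (p : ℝ[X]) :
    invMoment t (m + 1) (X * p) = invMoment t m p := by
  refine integral_congr_ae ?_
  filter_upwards [Measure.ae_ne volume 0] with x hx
  simp only [eval_mul, eval_X, pow_succ]
  field_simp

theorem invMoment_comp_neg_X (t : ℝ) (m : ℕ) (p : ℝ[X]) :
    invMoment t m (p.comp (-X)) = (-1) ^ m * invMoment t m p := by
  rw [invMoment, invMoment, ← integral_neg_eq_self, ← integral_const_mul]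
  congr 1 with x
  simp only [eval_comp, eval_neg, eval_X, neg_neg, inv_neg, weight_neg]
  rw [neg_pow]; ring

theorem invMoment_sq_pos {t : ℝ} (ht : 0 < t) (k : ℕ) {p : ℝ[X]} (hp : p ≠ 0) :
    0 < invMoment t (2 * k) (p ^ 2) := by
  have hnn : 0 ≤ fun x : ℝ => (p ^ 2).eval x * x⁻¹ ^ (2 * k) * weight x t := fun x => by
    have := weight_pos x t
    simp only [eval_pow, pow_mul, Pi.zero_apply]
    positivity
  rw [invMoment, integral_pos_iff_support_of_nonneg hnn (integrable_mul_weight ht _ _)]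
  have hfin : (insert 0 (p.roots.toFinset : Set ℝ)).Finite := (Finset.finite_toSet _).insert _
  have h0 : volume (insert 0 (p.roots.toFinset : Set ℝ)) = 0 := hfin.measure_zero _
  have : (insert 0 (p.roots.toFinset : Set ℝ))ᶜ ⊆
      Function.support fun x : ℝ => (p ^ 2).eval x * x⁻¹ ^ (2 * k) * weight x t := by
    intro x hx
    simp only [Set.mem_compl_iff, Set.mem_insert_iff, Finset.mem_coe, Multiset.mem_toFinset,
      mem_roots hp, IsRoot.def, not_or] at hx
    have := (weight_pos x t).ne'
    simp only [Function.mem_support, eval_pow]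
    have := hx.1
    have := hx.2
    positivity
  refine lt_of_lt_of_le ?_ (measure_mono this)
  have h1 : volume (Set.univ : Set ℝ) ≤
      volume (insert 0 (p.roots.toFinset : Set ℝ)) + volume (insert 0 (p.roots.toFinset : Set ℝ))ᶜ := by
    rw [← Set.union_compl_self (insert 0 (p.roots.toFinset : Set ℝ))]
    exact measure_union_le _ _
  rw [h0, zero_add] at h1
  exact lt_of_lt_of_le (by simp) h1

/-- Differentiating the weight in `t` brings down `-x^(-2)`. For `s > t/2` the weight at `s` lies
below the weight at `t/2`, which gives an integrable bound. -/
theorem hasDerivAt_invMoment {t : ℝ} (ht : 0 < t) (m : ℕ) (p : ℝ[X]) :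
    HasDerivAt (fun s => invMoment s m p) (-invMoment t (m + 2) p) t := by
  have hint := (integrable_mul_weight (half_pos ht) (m + 2) p).norm
  have key := hasDerivAt_integral_of_dominated_loc_of_deriv_le (μ := volume)
    (F := fun s x : ℝ => p.eval x * x⁻¹ ^ m * weight x s)
    (F' := fun s x : ℝ => -(p.eval x * x⁻¹ ^ (m + 2) * weight x s))
    (x₀ := t) (s := Set.Ioi (t / 2)) (Ioi_mem_nhds (by linarith))
    (.of_forall fun s => aestronglyMeasurable_mul_weight s m p)
    (integrable_mul_weight ht m p)
    (aestronglyMeasurable_mul_weight t (m + 2) p).neg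
    (bound := fun x => ‖p.eval x * x⁻¹ ^ (m + 2) * weight x (t / 2)‖)
    (.of_forall fun x s hs => ?_) hint (.of_forall fun x s _ => ?_)
  · have h2 := key.2
    rw [integral_neg] at h2
    exact h2
  · rw [norm_neg, norm_mul, norm_mul _ (weight x (t / 2)), Real.norm_of_nonneg (weight_pos x s).le,
      Real.norm_of_nonneg (weight_pos _ _).le]
    gcongr
    simp only [weight]
    gcongr
    exact (Set.mem_Ioi.1 hs).le
  · have h1 : HasDerivAt (fun s => -x ^ 2 - s / x ^ 2) (-(1 / x ^ 2)) s := by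
      simpa using ((hasDerivAt_id s).div_const (x ^ 2)).const_sub (-x ^ 2)
    refine (h1.exp.const_mul (p.eval x * x⁻¹ ^ m)).congr_deriv ?_
    rw [weight, pow_add, one_div, ← inv_pow]
    ring

theorem hasDerivAt_weight {x : ℝ} (hx : x ≠ 0) (t : ℝ) :
    HasDerivAt (fun y => weight y t) ((-2 * x + 2 * t * x⁻¹ ^ 3) * weight x t) x := by
  have h1 : HasDerivAt (fun y : ℝ => -y ^ 2 - t / y ^ 2) (-2 * x + 2 * t * x⁻¹ ^ 3) x := by
    have h2 := ((hasDerivAt_pow 2 x).neg).sub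
      ((hasDerivAt_const x t).div (hasDerivAt_pow 2 x) (pow_ne_zero 2 hx))
    refine h2.congr_deriv ?_
    field_simp
    ring
  refine HasDerivAt.congr_deriv (f := fun y => weight y t) h1.exp ?_
  rw [weight]; ring

/-- Integration by parts against the weight. -/
theorem invMoment_derivative {t : ℝ} (ht : 0 < t) (p : ℝ[X]) :
    invMoment t 0 (derivative p) = 2 * invMoment t 0 (X * p) - 2 * t * invMoment t 3 p := by
  -- `weight` has the value `1` at `x = 0`, hence jumps there. Replacing `exp (-t/x^2)` by its
  -- smooth extension makes the function differentiable on the whole line without changing any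
  -- integral.
  set f : ℝ → ℝ := fun x => p.eval x * (Real.exp (-x ^ 2) * expNegInvGlue (x ^ 2 / t)) with hf
  have hfw : ∀ x ≠ 0, f x = p.eval x * weight x t := fun x hx => by
    have : ¬ x ^ 2 / t ≤ 0 := not_le.2 (by positivity)
    simp only [hf, expNegInvGlue, this, if_false, ← Real.exp_add, weight, inv_div, sub_eq_add_neg]
  have hdiff : Differentiable ℝ f := by
    have h1 : Differentiable ℝ expNegInvGlue :=
      (expNegInvGlue.contDiff (n := 1)).differentiable (by simp)
    have h2 : Differentiable ℝ fun x : ℝ => expNegInvGlue (x ^ 2 / t) := h1.comp (by fun_prop)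
    exact p.differentiable.mul ((by fun_prop : Differentiable ℝ fun x : ℝ => Real.exp (-x ^ 2)).mul h2)
  set g : ℝ → ℝ := fun x => (derivative p).eval x * x⁻¹ ^ 0 * weight x t
    - 2 * ((X * p).eval x * x⁻¹ ^ 0 * weight x t) + 2 * t * (p.eval x * x⁻¹ ^ 3 * weight x t) with hg
  have hgi : Integrable g :=
    ((integrable_mul_weight ht 0 _).sub ((integrable_mul_weight ht 0 _).const_mul 2)).add
      ((integrable_mul_weight ht 3 _).const_mul (2 * t))
  have hae : deriv f =ᵐ[volume] g := by
    filter_upwards [Measure.ae_ne volume 0] with x hx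
    have h1 : HasDerivAt (fun y => p.eval y * weight y t) _ x :=
      (p.hasDerivAt x).mul (hasDerivAt_weight hx t)
    have h2 : f =ᶠ[nhds x] fun y => p.eval y * weight y t := by
      filter_upwards [isOpen_ne.mem_nhds hx] with y hy using hfw y hy
    rw [(h1.congr_of_eventuallyEq h2).deriv]
    simp only [hg, eval_mul, eval_X]
    ring
  have hfi : Integrable f := by
    refine (integrable_mul_weight ht 0 p).congr ?_
    filter_upwards [Measure.ae_ne volume 0] with x hx
    rw [hfw x hx]; simp
  have hzero := MeasureTheory.integral_eq_zero_of_hasDerivAt_of_integrable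
    (fun x => (hdiff x).hasDerivAt) (hgi.congr hae.symm) hfi
  rw [integral_congr_ae hae, hg, integral_add, integral_sub, integral_const_mul,
    integral_const_mul] at hzero
  · simp only [invMoment]; linarith
  · exact integrable_mul_weight ht 0 _
  · exact (integrable_mul_weight ht 0 _).const_mul 2
  · exact (integrable_mul_weight ht 0 _).sub ((integrable_mul_weight ht 0 _).const_mul 2)
  · exact (integrable_mul_weight ht 3 _).const_mul (2 * t)

/-! ### Orthogonal polynomials: uniqueness, parity, recurrence -/

theorem pairing_eq_invMoment (t : ℝ) (p q : ℝ[X]) : pairing t p q = invMoment t 0 (p * q) := by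
  simp [pairing, invMoment]

theorem pairing_comm (t : ℝ) (p q : ℝ[X]) : pairing t p q = pairing t q p := by
  rw [pairing_eq_invMoment, pairing_eq_invMoment, mul_comm]

theorem pairing_C_mul (t a : ℝ) (p q : ℝ[X]) : pairing t (C a * p) q = a * pairing t p q := by
  rw [pairing_eq_invMoment, pairing_eq_invMoment, mul_assoc, invMoment_C_mul]

theorem pairing_X_mul (t : ℝ) (p q : ℝ[X]) : pairing t (X * p) q = pairing t p (X * q) := by
  rw [pairing_eq_invMoment, pairing_eq_invMoment]; congr 1; ring

theorem pairing_comp_neg_X (t : ℝ) (p q : ℝ[X]) :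
    pairing t (p.comp (-X)) q = pairing t p (q.comp (-X)) := by
  rw [pairing_eq_invMoment, pairing_eq_invMoment,
    show p * q.comp (-X) = (p.comp (-X) * q).comp (-X) by
      rw [mul_comp, comp_neg_X_comp_neg_X], invMoment_comp_neg_X]
  simp

theorem P_eq (t : ℝ) (n : ℕ) : P t n = X ^ n - ∑ k ∈ Finset.range n,
    C (pairing t (X ^ n) (P t k) / pairing t (P t k) (P t k)) * P t k := by
  rw [P, Finset.sum_range]

theorem degree_C_mul_le_degree (a : ℝ) (p : ℝ[X]) : (C a * p).degree ≤ p.degree := by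
  rw [← smul_eq_C_mul]; exact degree_smul_le a p

theorem P_degree_aux (t : ℝ) (n : ℕ) (a : ℕ → ℝ) (ih : ∀ k < n, (P t k).degree = k) :
    (∑ k ∈ Finset.range n, C (a k) * P t k).degree < n := by
  rw [← mem_degreeLT]
  refine Submodule.sum_mem _ fun k hk => ?_
  rw [mem_degreeLT]
  have hk := Finset.mem_range.1 hk
  refine lt_of_le_of_lt (degree_C_mul_le_degree _ _) ?_
  rw [ih k hk]
  exact_mod_cast hk

theorem P_degree (t : ℝ) (n : ℕ) : (P t n).degree = n := by
  induction n using Nat.strong_induction_on with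
  | _ n ih =>
    rw [P_eq, degree_sub_eq_left_of_degree_lt, degree_X_pow]
    rw [degree_X_pow]
    exact P_degree_aux t n _ ih

theorem P_natDegree (t : ℝ) (n : ℕ) : (P t n).natDegree = n :=
  natDegree_eq_of_degree_eq_some (P_degree t n)

theorem P_monic (t : ℝ) (n : ℕ) : (P t n).Monic := by
  rw [P_eq]
  refine (monic_X_pow n).sub_of_left ?_
  rw [degree_X_pow]
  exact P_degree_aux t n _ fun k _ => P_degree t k

theorem P_zero (t : ℝ) : P t 0 = 1 := by rw [P_eq]; simp

section Orthogonality

variable {t : ℝ}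

theorem pairing_sub (ht : 0 < t) (p q s : ℝ[X]) :
    pairing t (p - q) s = pairing t p s - pairing t q s := by
  simp only [pairing_eq_invMoment, sub_mul, invMoment_sub ht]

theorem pairing_sum (ht : 0 < t) {ι : Type*} (u : Finset ι) (f : ι → ℝ[X]) (s : ℝ[X]) :
    pairing t (∑ i ∈ u, f i) s = ∑ i ∈ u, pairing t (f i) s := by
  simp only [pairing_eq_invMoment, Finset.sum_mul, invMoment_sum ht]

theorem pairing_self_pos (ht : 0 < t) {p : ℝ[X]} (hp : p ≠ 0) : 0 < pairing t p p := by
  rw [pairing_eq_invMoment, ← sq]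
  exact invMoment_sq_pos ht 0 hp

theorem h_pos (ht : 0 < t) (n : ℕ) : 0 < h n t := pairing_self_pos ht (P_monic t n).ne_zero

theorem pairing_P_of_lt (ht : 0 < t) {k n : ℕ} (hk : k < n) : pairing t (P t n) (P t k) = 0 := by
  induction n using Nat.strong_induction_on generalizing k with
  | _ n ih =>
    rw [P_eq t n, pairing_sub ht, pairing_sum ht, Finset.sum_eq_single k]
    · rw [pairing_C_mul, div_mul_cancel₀ _ (pairing_self_pos ht (P_monic t k).ne_zero).ne', sub_self]
    · intro j hj hjk
      rw [pairing_C_mul]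
      rcases lt_or_gt_of_ne hjk with hlt | hlt
      · rw [pairing_comm t (P t j) (P t k), ih k hk hlt, mul_zero]
      · rw [ih j (Finset.mem_range.1 hj) hlt, mul_zero]
    · intro hk'
      exact absurd (Finset.mem_range.2 hk) hk'

theorem pairing_P_of_ne (ht : 0 < t) {m n : ℕ} (hmn : m ≠ n) : pairing t (P t m) (P t n) = 0 := by
  rcases lt_or_gt_of_ne hmn with hlt | hlt
  · rw [pairing_comm, pairing_P_of_lt ht hlt]
  · exact pairing_P_of_lt ht hlt

theorem P_isMonicOrthogonal (ht : 0 < t) : IsMonicOrthogonal t (P t) := by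
  refine ⟨fun n => ⟨P_monic t n, P_natDegree t n⟩, fun m n => ?_, fun m n => pairing_P_of_ne ht,
    h_pos ht⟩
  simpa using integrable_mul_weight ht 0 (P t m * P t n)

theorem degree_sub_C_mul_P_lt {q : ℝ[X]} {n : ℕ} (hq : q.degree < (n + 1 : ℕ)) :
    (q - C (q.coeff n) * P t n).degree < n := by
  rw [degree_lt_iff_coeff_zero] at hq ⊢
  intro m hm
  rw [coeff_sub, coeff_C_mul]
  rcases hm.eq_or_lt with rfl | hlt
  · have : (P t n).coeff n = 1 := by simpa [P_natDegree] using (P_monic t n).coeff_natDegree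
    rw [this]; ring
  · rw [hq m hlt, coeff_eq_zero_of_natDegree_lt (p := P t n) (by rwa [P_natDegree])]; ring

/-- A polynomial orthogonal to `P_0, …, P_(n-1)` is orthogonal to all polynomials of degree
less than `n`. -/
theorem pairing_eq_zero_of_degree_lt (ht : 0 < t) {p : ℝ[X]} {n : ℕ}
    (hp : ∀ k < n, pairing t (P t k) p = 0) {q : ℝ[X]} (hq : q.degree < n) :
    pairing t q p = 0 := by
  induction n generalizing q with
  | zero =>
    have : q = 0 := by simpa using hq
    simp [this, pairing]
  | succ n ih =>
    have := ih (fun k hk => hp k (by omega)) (degree_sub_C_mul_P_lt (t := t) hq)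
    rwa [pairing_sub ht, pairing_C_mul, hp n (by omega), mul_zero, sub_zero] at this

theorem pairing_P_eq_zero (ht : 0 < t) {n : ℕ} {q : ℝ[X]} (hq : q.degree < n) :
    pairing t q (P t n) = 0 :=
  pairing_eq_zero_of_degree_lt ht (fun _ hk => pairing_P_of_ne ht hk.ne) hq

/-- Pairing with `P_n` reads off the coefficient of degree `n`. -/
theorem pairing_P_eq (ht : 0 < t) {n : ℕ} {q : ℝ[X]} (hq : q.degree < (n + 1 : ℕ)) :
    pairing t q (P t n) = q.coeff n * h n t := by
  have := pairing_P_eq_zero ht (degree_sub_C_mul_P_lt (t := t) hq)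
  rw [pairing_sub ht, pairing_C_mul] at this
  rw [h]; linarith

/-- The difference of two candidates has degree below `n`, so it is orthogonal to itself. Parity and
the recurrence both rest on this uniqueness. -/
theorem eq_P_of_orthogonal (ht : 0 < t) {p : ℝ[X]} {n : ℕ} (hm : p.Monic) (hd : p.degree = n)
    (hp : ∀ k < n, pairing t (P t k) p = 0) : p = P t n := by
  by_contra hne
  have hlt : (p - P t n).degree < n := by
    rw [← hd]
    exact degree_sub_lt_left (by rw [hd, P_degree]) hm.ne_zero
      (by rw [hm.leadingCoeff, (P_monic t n).leadingCoeff])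
  have h1 := pairing_eq_zero_of_degree_lt ht hp hlt
  have h2 := pairing_P_eq_zero ht hlt
  have h3 := pairing_self_pos ht (sub_ne_zero.2 hne)
  rw [pairing_comm, pairing_sub ht, pairing_comm, h1, pairing_comm t (P t n), h2] at h3
  simp at h3

/-- The weight is even, so the reflected polynomial, normalized to be monic, is again orthogonal to
lower degrees. -/
theorem P_comp_neg_X (ht : 0 < t) (n : ℕ) : (P t n).comp (-X) = (-1) ^ n * P t n := by
  have hdeg : ∀ p : ℝ[X], (p.comp (-X)).natDegree = p.natDegree := fun p => by
    simp [natDegree_comp]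
  have hm : ((-1) ^ n * (P t n).comp (-X)).Monic := by
    have := (P_monic t n).neg_one_pow_natDegree_mul_comp_neg_X
    rwa [P_natDegree] at this
  have hC : ((-1) ^ n : ℝ[X]) = C ((-1) ^ n) := by simp
  have key : (-1) ^ n * (P t n).comp (-X) = P t n := by
    refine eq_P_of_orthogonal ht hm ?_ fun k hk => ?_
    · rw [degree_eq_natDegree hm.ne_zero, hC, natDegree_C_mul (by simp), hdeg, P_natDegree]
    · rw [pairing_comm, hC, pairing_C_mul, pairing_comp_neg_X, pairing_comm, pairing_P_eq_zero ht,
        mul_zero]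
      refine lt_of_le_of_lt degree_le_natDegree ?_
      rw [hdeg, P_natDegree]
      exact_mod_cast hk
  have hsq : ((-1) ^ n * (-1) ^ n : ℝ[X]) = 1 := by rw [← mul_pow]; simp
  calc (P t n).comp (-X) = (-1) ^ n * ((-1) ^ n * (P t n).comp (-X)) := by
        rw [← mul_assoc, hsq, one_mul]
    _ = _ := by rw [key]

theorem coeff_comp_neg_X (p : ℝ[X]) (i : ℕ) : (p.comp (-X)).coeff i = (-1) ^ i * p.coeff i := by
  have := comp_C_mul_X_coeff (p := p) (r := (-1 : ℝ)) (n := i)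
  rw [mul_comm, ← this]; simp

theorem P_coeff_eq_zero (ht : 0 < t) {n i : ℕ} (hni : Odd (n + i)) : (P t n).coeff i = 0 := by
  have h1 := congrArg (fun p => coeff p i) (P_comp_neg_X ht n)
  simp only [coeff_comp_neg_X] at h1
  rw [show ((-1) ^ n : ℝ[X]) = C ((-1) ^ n) by simp, coeff_C_mul] at h1
  have h2 : (-1 : ℝ) ^ n * (-1) ^ i = -1 := by rw [← pow_add, hni.neg_one_pow]
  have h3 : (-1 : ℝ) ^ n * (-1) ^ n = 1 := by rw [← mul_pow]; simp
  have : (-1 : ℝ) ^ n * ((-1) ^ i * (P t n).coeff i) = (-1) ^ n * ((-1) ^ n * (P t n).coeff i) := by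
    rw [h1]
  rw [← mul_assoc, ← mul_assoc, h2, h3] at this
  linarith

theorem pairing_P_X_mul_P (ht : 0 < t) (n : ℕ) : pairing t (P t n) (X * P t n) = 0 := by
  have h1 := invMoment_comp_neg_X t 0 (P t n * (X * P t n))
  have hsq : ((-1) ^ n * (-1) ^ n : ℝ[X]) = 1 := by rw [← mul_pow]; simp
  have h2 : (P t n * (X * P t n)).comp (-X) = C (-1) * (P t n * (X * P t n)) := by
    rw [mul_comp, mul_comp, P_comp_neg_X ht, X_comp]
    calc _ = ((-1) ^ n * (-1) ^ n) * -(P t n * (X * P t n)) := by ring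
      _ = _ := by rw [hsq]; simp
  rw [h2, invMoment_C_mul] at h1
  rw [pairing_eq_invMoment]
  linarith

theorem P_one (ht : 0 < t) : P t 1 = X := by
  refine (eq_P_of_orthogonal ht monic_X (by simp) fun k hk => ?_).symm
  obtain rfl : k = 0 := by omega
  simpa [P_zero] using pairing_P_X_mul_P ht 0

/-- The three term recurrence. -/
theorem X_mul_P_succ (ht : 0 < t) (n : ℕ) :
    X * P t (n + 1) = P t (n + 2) + C (h (n + 1) t / h n t) * P t n := by
  have hdlt : (C (h (n + 1) t / h n t) * P t n).degree < (X * P t (n + 1)).degree := by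
    rw [degree_mul (p := X), degree_X, P_degree]
    refine lt_of_le_of_lt (degree_C_mul_le_degree _ _) ?_
    rw [P_degree]
    exact_mod_cast (by omega : n < 1 + (n + 1))
  rw [← sub_eq_iff_eq_add]
  refine eq_P_of_orthogonal ht ((monic_X.mul (P_monic t _)).sub_of_left hdlt) ?_ fun k hk => ?_
  · rw [degree_sub_eq_left_of_degree_lt hdlt, degree_mul, degree_X, P_degree]
    push_cast; ring
  · rw [pairing_comm, pairing_sub ht, pairing_C_mul]
    rcases (by omega : k = n + 1 ∨ k = n ∨ k < n) with rfl | rfl | hlt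
    · rw [pairing_comm, pairing_P_X_mul_P ht, pairing_P_of_ne ht (by omega)]; ring
    · have h1 : pairing t (X * P t k) (P t (k + 1)) = h (k + 1) t := by
        rw [pairing_P_eq ht]
        · have : (P t k).coeff k = 1 := by simpa [P_natDegree] using (P_monic t k).coeff_natDegree
          rw [coeff_X_mul, this, one_mul]
        · rw [degree_mul, degree_X, P_degree]
          exact_mod_cast (by omega : 1 + k < k + 1 + 1)
      rw [pairing_X_mul, pairing_comm, h1, ← h, div_mul_cancel₀ _ (h_pos ht k).ne', sub_self]
    · rw [pairing_X_mul, pairing_comm, pairing_P_eq_zero ht, pairing_P_of_ne ht (by omega)]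
      · ring
      · rw [degree_mul, degree_X, P_degree]
        exact_mod_cast (by omega : 1 + k < n + 1)

end Orthogonality

/-! ### Identities at fixed `t` -/

theorem R_eq (n : ℕ) (t : ℝ) : R n t = 2 * t / h n t * invMoment t 2 (P t n * P t n) := by
  rw [R, invMoment]
  congr 2 with x
  simp only [eval_mul, one_div, inv_pow]
  ring

theorem r_succ_eq (n : ℕ) (t : ℝ) :
    r (n + 1) t = 2 * t / h n t * invMoment t 3 (P t (n + 1) * P t n) := by
  rw [r, invMoment]
  congr 2 with x
  simp only [eval_mul, one_div, inv_pow]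
  ring

section FixedTime

variable {t : ℝ}

theorem R_pos (ht : 0 < t) (n : ℕ) : 0 < R n t := by
  have h1 := h_pos ht n
  have h2 := invMoment_sq_pos ht 1 (P_monic t n).ne_zero
  rw [R_eq, ← sq]
  positivity

/-- Write `y^(-2) P_n^2` as `y^(-3) (y P_n) P_n` and expand `y P_n` by the recurrence. -/
theorem R_eq_r_add_r (ht : 0 < t) (n : ℕ) : R n t = r n t + r (n + 1) t := by
  rw [R_eq, r_succ_eq, ← invMoment_succ_X_mul]
  cases n with
  | zero => simp [r, P_one ht, P_zero]
  | succ n =>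
    have hn := (h_pos ht n).ne'
    have hn1 := (h_pos ht (n + 1)).ne'
    rw [r_succ_eq, ← mul_assoc, X_mul_P_succ ht, add_mul, invMoment_add ht, mul_assoc,
      invMoment_C_mul, mul_comm (P t n)]
    field_simp
    ring

theorem P_coeff_self (t : ℝ) (n : ℕ) : (P t n).coeff n = 1 := by
  simpa [P_natDegree] using (P_monic t n).coeff_natDegree

theorem P_coeff_of_lt (t : ℝ) {n i : ℕ} (hi : n < i) : (P t n).coeff i = 0 :=
  coeff_eq_zero_of_natDegree_lt (by rwa [P_natDegree])

/-- Integrate by parts with `p = P_(n+1) P_n`: orthogonality leaves `(n+1) h_n` from the derivative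
and `h_(n+1)` from `x p`. -/
theorem two_mul_h_succ_div (ht : 0 < t) (n : ℕ) :
    2 * (h (n + 1) t / h n t) = (n + 1 : ℕ) + r (n + 1) t := by
  have hn := (h_pos ht n).ne'
  have key := invMoment_derivative ht (P t (n + 1) * P t n)
  rw [derivative_mul, invMoment_add ht, ← pairing_eq_invMoment, ← pairing_eq_invMoment,
    pairing_P_eq ht, pairing_comm, pairing_P_eq_zero ht, mul_left_comm, ← pairing_eq_invMoment,
    pairing_comm t (P t (n + 1)), pairing_P_eq ht, coeff_derivative, coeff_X_mul, P_coeff_self,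
    P_coeff_self] at key
  · rw [r_succ_eq]
    push_cast
    field_simp
    linarith
  · rw [degree_mul, degree_X, P_degree]
    exact_mod_cast (by omega : 1 + n < n + 1 + 1)
  · refine lt_of_le_of_lt (degree_derivative_le) ?_
    rw [P_degree]
    exact_mod_cast (by omega : n < n + 1)
  · refine lt_of_lt_of_eq (degree_derivative_lt (P_monic t _).ne_zero) ?_
    rw [P_degree]

/-- Without a linear term, `(p - p(0)) / x^2` is a polynomial of degree below `m`, hence orthogonal
to `P_m`. -/
theorem invMoment_two_mul_P (ht : 0 < t) {m : ℕ} {p : ℝ[X]} (hp : p.degree < (m + 2 : ℕ))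
    (hp1 : p.coeff 1 = 0) :
    invMoment t 2 (p * P t m) = p.coeff 0 * invMoment t 2 (P t m) := by
  have hdecomp : p * P t m = X * (X * (p.divX.divX * P t m)) + C (p.coeff 0) * P t m := by
    have h1 := divX_mul_X_add p
    have h2 := divX_mul_X_add p.divX
    rw [coeff_divX, zero_add, hp1, C_0, add_zero] at h2
    linear_combination -(P t m) * h1 - X * P t m * h2
  have hdeg : p.divX.divX.degree < m := by
    rw [degree_lt_iff_coeff_zero] at hp ⊢
    intro i hi
    rw [coeff_divX, coeff_divX]
    exact hp _ (by omega)
  rw [hdecomp, invMoment_add ht, invMoment_C_mul, invMoment_succ_X_mul, invMoment_succ_X_mul,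
    ← pairing_eq_invMoment, pairing_P_eq_zero ht hdeg, zero_add]

theorem pairing_eq_pairing_divX (t : ℝ) {p : ℝ[X]} (hp : p.coeff 0 = 0) (q : ℝ[X]) :
    pairing t p q = pairing t p.divX (X * q) := by
  have h1 := divX_mul_X_add p
  rw [hp, C_0, add_zero] at h1
  rw [← pairing_X_mul, mul_comm, h1]

theorem X_mul_divX_of_coeff_zero {p : ℝ[X]} (hp : p.coeff 0 = 0) : X * p.divX = p := by
  have h1 := divX_mul_X_add p
  rwa [hp, C_0, add_zero, mul_comm] at h1

/-- One of `P_n`, `P_(n+1)` is odd, say `x Q`. Its moment becomes the squared norm of `Q`, the other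
integrals reduce to values at `0` by `invMoment_two_mul_P`, and `e4` links those values. -/
theorem invMoment_mul_invMoment (ht : 0 < t) (n : ℕ) :
    invMoment t 2 (P t (n + 1) * P t (n + 1)) * invMoment t 2 (P t n * P t n)
      = (-1) ^ n * h n t * invMoment t 3 (P t (n + 1) * P t n) := by
  have hPdeg : ∀ m, (P t m).degree < (m + 2 : ℕ) := fun m => by
    rw [P_degree]; exact_mod_cast (by omega : m < m + 2)
  rcases Nat.even_or_odd n with hn | hn
  · have h0 : (P t (n + 1)).coeff 0 = 0 := P_coeff_eq_zero ht hn.add_one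
    have h1 : (P t n).coeff 1 = 0 := P_coeff_eq_zero ht hn.add_one
    set Q := (P t (n + 1)).divX with hQ
    have hXQ : X * Q = P t (n + 1) := X_mul_divX_of_coeff_zero h0
    have hQd : Q.degree < (n + 1 : ℕ) := by
      rw [degree_lt_iff_coeff_zero]
      intro i hi
      rw [hQ, coeff_divX, P_coeff_of_lt t (by omega)]
    have hQ1 : Q.coeff 1 = 0 := by
      rw [hQ, coeff_divX]; exact P_coeff_eq_zero ht (by rw [Nat.odd_iff]; rw [Nat.even_iff] at hn; omega)
    have hQn : Q.coeff n = 1 := by rw [hQ, coeff_divX, P_coeff_self]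
    have e1 : invMoment t 2 (P t (n + 1) * P t (n + 1)) = pairing t Q Q := by
      rw [← hXQ, mul_mul_mul_comm, mul_assoc, invMoment_succ_X_mul, invMoment_succ_X_mul,
        pairing_eq_invMoment]
    have e2 := invMoment_two_mul_P ht (hPdeg n) h1
    have e3 : invMoment t 3 (P t (n + 1) * P t n) = Q.coeff 0 * invMoment t 2 (P t n) := by
      rw [← hXQ, mul_assoc, invMoment_succ_X_mul]
      exact invMoment_two_mul_P ht (hQd.trans (by exact_mod_cast (by omega : n + 1 < n + 2))) hQ1
    have e4 : (P t n).coeff 0 * pairing t Q Q = Q.coeff 0 * h n t := by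
      -- The combination is chosen to vanish at `0`; moving one factor `x` across turns `Q` into
      -- `P_(n+1)`, which kills the quotient.
      have h2 : pairing t (C ((P t n).coeff 0) * Q - C (Q.coeff 0) * P t n) Q = 0 := by
        rw [pairing_eq_pairing_divX t (by simp [mul_comm]), hXQ, pairing_P_eq_zero ht]
        rw [degree_lt_iff_coeff_zero]
        intro i hi
        rw [coeff_divX, coeff_sub, coeff_C_mul, coeff_C_mul, P_coeff_of_lt t (by omega : n < i + 1),
          coeff_eq_zero_of_degree_lt (hQd.trans_le (by exact_mod_cast (by omega : n + 1 ≤ i + 1)))]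
        ring
      rw [pairing_sub ht, pairing_C_mul, pairing_C_mul, pairing_comm t (P t n),
        pairing_P_eq ht hQd, hQn] at h2
      linarith
    rw [e1, e2, e3, hn.neg_one_pow]
    linear_combination invMoment t 2 (P t n) * e4
  · have h0 : (P t n).coeff 0 = 0 := P_coeff_eq_zero ht hn
    have h1 : (P t (n + 1)).coeff 1 = 0 :=
      P_coeff_eq_zero ht (by rw [Nat.odd_iff] at hn ⊢; omega)
    set Q := (P t n).divX with hQ
    have hXQ : X * Q = P t n := X_mul_divX_of_coeff_zero h0
    have hQd : Q.degree < (n + 1 : ℕ) := by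
      rw [degree_lt_iff_coeff_zero]
      intro i hi
      rw [hQ, coeff_divX, P_coeff_of_lt t (by omega)]
    have hQ1 : Q.coeff 1 = 0 := by
      rw [hQ, coeff_divX]; exact P_coeff_eq_zero ht (by rw [Nat.odd_iff] at hn ⊢; omega)
    have e1 : invMoment t 2 (P t n * P t n) = pairing t Q Q := by
      rw [← hXQ, mul_mul_mul_comm, mul_assoc, invMoment_succ_X_mul, invMoment_succ_X_mul,
        pairing_eq_invMoment]
    have e2 := invMoment_two_mul_P ht (hPdeg (n + 1)) h1
    have e3 : invMoment t 3 (P t (n + 1) * P t n) = Q.coeff 0 * invMoment t 2 (P t (n + 1)) := by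
      rw [← hXQ, mul_left_comm, invMoment_succ_X_mul, mul_comm]
      exact invMoment_two_mul_P ht (hQd.trans (by exact_mod_cast (by omega : n + 1 < n + 1 + 2))) hQ1
    have e4 : (P t (n + 1)).coeff 0 * pairing t Q Q = -Q.coeff 0 * h n t := by
      -- Here the quotient has degree exactly up to `n`, and its coefficient `-Q(0)` there survives
      -- against `P_n`: this is the source of the sign `(-1)^n`.
      have h2 : pairing t (C ((P t (n + 1)).coeff 0) * Q - C (Q.coeff 0) * P t (n + 1)) Q
          = -Q.coeff 0 * h n t := by
        rw [pairing_eq_pairing_divX t (by simp [mul_comm]), hXQ, pairing_P_eq ht]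
        · rw [coeff_divX, coeff_sub, coeff_C_mul, coeff_C_mul, P_coeff_self,
            coeff_eq_zero_of_degree_lt hQd]
          ring
        · rw [degree_lt_iff_coeff_zero]
          intro i hi
          rw [coeff_divX, coeff_sub, coeff_C_mul, coeff_C_mul,
            P_coeff_of_lt t (by omega : n + 1 < i + 1),
            coeff_eq_zero_of_degree_lt (hQd.trans_le (by exact_mod_cast (by omega : n + 1 ≤ i + 1)))]
          ring
      rw [pairing_sub ht, pairing_C_mul, pairing_C_mul, pairing_comm t (P t (n + 1)),
        pairing_P_eq_zero ht hQd] at h2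
      linarith
    rw [e1, e2, e3, hn.neg_one_pow]
    linear_combination invMoment t 2 (P t (n + 1)) * e4

theorem h_div_mul_R_mul_R (ht : 0 < t) (n : ℕ) :
    h (n + 1) t / h n t * R (n + 1) t * R n t = 2 * (-1) ^ n * t * r (n + 1) t := by
  have hn := (h_pos ht n).ne'
  have hn1 := (h_pos ht (n + 1)).ne'
  have key := invMoment_mul_invMoment ht n
  rw [R_eq, R_eq, r_succ_eq]
  field_simp
  linear_combination key

end FixedTime

/-! ### Dependence on `t` and the first order system -/

/-- Separates the `t`-dependence of the coefficients from that of the moments. -/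
theorem pairing_eq_sum {t : ℝ} (ht : 0 < t) {p q : ℝ[X]} {N : ℕ} (hp : p.natDegree < N)
    (hq : q.natDegree < N) :
    pairing t p q = ∑ i ∈ Finset.range N, ∑ j ∈ Finset.range N,
      p.coeff i * (q.coeff j * invMoment t 0 (X ^ i * X ^ j)) := by
  rw [pairing_eq_invMoment]
  nth_rewrite 1 [p.as_sum_range' N hp, q.as_sum_range' N hq]
  rw [Finset.sum_mul_sum, invMoment_sum ht]
  refine Finset.sum_congr rfl fun i _ => ?_
  rw [invMoment_sum ht]
  refine Finset.sum_congr rfl fun j _ => ?_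
  rw [← C_mul_X_pow_eq_monomial, ← C_mul_X_pow_eq_monomial, mul_mul_mul_comm, mul_assoc,
    invMoment_C_mul, invMoment_C_mul]

theorem differentiableAt_pairing {t : ℝ} (ht : 0 < t) {p q : ℝ → ℝ[X]} (N : ℕ)
    (hp : ∀ s, (p s).natDegree < N) (hq : ∀ s, (q s).natDegree < N)
    (hp' : ∀ i, DifferentiableAt ℝ (fun s => (p s).coeff i) t)
    (hq' : ∀ i, DifferentiableAt ℝ (fun s => (q s).coeff i) t) :
    DifferentiableAt ℝ (fun s => pairing s (p s) (q s)) t := by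
  have h1 : DifferentiableAt ℝ (fun s => ∑ i ∈ Finset.range N, ∑ j ∈ Finset.range N,
      (p s).coeff i * ((q s).coeff j * invMoment s 0 (X ^ i * X ^ j))) t :=
    DifferentiableAt.fun_sum fun i _ => DifferentiableAt.fun_sum fun j _ =>
      (hp' i).mul ((hq' j).mul (hasDerivAt_invMoment ht 0 _).differentiableAt)
  refine h1.congr_of_eventuallyEq ?_
  filter_upwards [lt_mem_nhds ht] with s hs using pairing_eq_sum hs (hp s) (hq s)

theorem differentiableAt_P_coeff {t : ℝ} (ht : 0 < t) (n i : ℕ) :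
    DifferentiableAt ℝ (fun s => (P s n).coeff i) t := by
  induction n using Nat.strong_induction_on generalizing i with
  | _ n ih =>
    have hexp : (fun s => (P s n).coeff i) = fun s => (X ^ n : ℝ[X]).coeff i -
        ∑ k ∈ Finset.range n,
          pairing s (X ^ n) (P s k) / pairing s (P s k) (P s k) * (P s k).coeff i := by
      funext s
      rw [P_eq s n, coeff_sub, finsetSum_coeff]
      simp only [coeff_C_mul]
    rw [hexp]
    refine (differentiableAt_const _).sub (DifferentiableAt.fun_sum fun k hk => ?_)
    have hk := Finset.mem_range.1 hk
    have hPk : ∀ s, (P s k).natDegree < n + 1 := fun s => by rw [P_natDegree]; omega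
    refine DifferentiableAt.mul (DifferentiableAt.div ?_ ?_ (h_pos ht k).ne') (ih k hk i)
    · exact differentiableAt_pairing ht (n + 1) (fun s => by simp) hPk
        (fun _ => differentiableAt_const _) (ih k hk)
    · exact differentiableAt_pairing ht (n + 1) hPk hPk (ih k hk) (ih k hk)

theorem differentiableAt_h {t : ℝ} (ht : 0 < t) (n : ℕ) : DifferentiableAt ℝ (h n) t := by
  have hP : ∀ s, (P s n).natDegree < n + 1 := fun s => by rw [P_natDegree]; omega
  exact differentiableAt_pairing ht (n + 1) hP hP (differentiableAt_P_coeff ht n)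
    (differentiableAt_P_coeff ht n)

/-- `P_n` minimizes the norm among the monic polynomials of degree `n`. -/
theorem h_le_pairing {t : ℝ} (ht : 0 < t) {n : ℕ} {q : ℝ[X]} (hm : q.Monic)
    (hd : q.degree = n) : h n t ≤ pairing t q q := by
  have hlt : (q - P t n).degree < n := by
    rw [← hd]
    exact degree_sub_lt_left (by rw [hd, P_degree]) hm.ne_zero
      (by rw [hm.leadingCoeff, (P_monic t n).leadingCoeff])
  have h1 := pairing_P_eq_zero ht hlt
  have h2 : 0 ≤ pairing t (q - P t n) (q - P t n) := by
    by_cases h0 : q - P t n = 0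
    · simp [h0, pairing]
    · exact (pairing_self_pos ht h0).le
  rw [pairing_sub ht] at h1
  rw [pairing_sub ht, pairing_comm t q, pairing_comm t (P t n), pairing_sub ht, pairing_sub ht,
    pairing_comm t (P t n) q] at h2
  rw [h]
  linarith

theorem hasDerivAt_h {t : ℝ} (ht : 0 < t) (n : ℕ) :
    HasDerivAt (h n) (-(h n t * R n t / (2 * t))) t := by
  have hg := hasDerivAt_invMoment ht 0 (P t n * P t n)
  have hh := (differentiableAt_h ht n).hasDerivAt
  -- Envelope argument: `P t n`, frozen at time `t`, is a competitor at every time `s`, so the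
  -- difference is at most `0`, with equality at `s = t`.
  have hmax : IsLocalMax (fun s => h n s - invMoment s 0 (P t n * P t n)) t := by
    filter_upwards [lt_mem_nhds ht] with s hs
    have := h_le_pairing hs (P_monic t n) (P_degree t n)
    rw [pairing_eq_invMoment] at this
    simp only [h, pairing_eq_invMoment] at this ⊢
    linarith
  have h0 := hmax.hasDerivAt_eq_zero (hh.sub hg)
  have hn := (h_pos ht n).ne'
  refine hh.congr_deriv ?_
  rw [R_eq]
  field_simp
  rw [zero_add] at h0
  linarith

theorem hasDerivAt_r_succ {t : ℝ} (ht : 0 < t) (n : ℕ) :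
    HasDerivAt (r (n + 1))
      (-(((n + 1 : ℕ) + r (n + 1) t) / (2 * t) * (R (n + 1) t - R n t))) t := by
  have hn := (h_pos ht n).ne'
  have h1 : HasDerivAt (fun s => 2 * (h (n + 1) s / h n s) - (n + 1 : ℕ)) _ t :=
    (((hasDerivAt_h ht (n + 1)).div (hasDerivAt_h ht n) hn).const_mul 2).sub_const _
  have h2 : r (n + 1) =ᶠ[nhds t] fun s => 2 * (h (n + 1) s / h n s) - (n + 1 : ℕ) := by
    filter_upwards [lt_mem_nhds ht] with s hs
    rw [two_mul_h_succ_div hs]; ring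
  refine (h1.congr_of_eventuallyEq h2).congr_deriv ?_
  rw [← two_mul_h_succ_div ht]
  field_simp
  ring

/-- For positive index, the term with the preceding `R` in `hasDerivAt_r_succ` is removed by the
product identity. -/
theorem hasDerivAt_r {t : ℝ} (ht : 0 < t) (n : ℕ) :
    HasDerivAt (r n) (-(2 * (-1) ^ n * r n t / R n t) - (n + r n t) / (2 * t) * R n t) t := by
  cases n with
  | zero =>
    have : r 0 = fun _ => 0 := rfl
    simpa [this] using hasDerivAt_const t (0 : ℝ)
  | succ n =>
    refine (hasDerivAt_r_succ ht n).congr_deriv ?_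
    have key := h_div_mul_R_mul_R ht n
    have hb := two_mul_h_succ_div ht n
    have hR := (R_pos ht (n + 1)).ne'
    have hb' : h (n + 1) t / h n t = ((n + 1 : ℕ) + r (n + 1) t) / 2 := by linarith
    rw [hb'] at key
    field_simp
    rw [pow_succ]
    linear_combination 2 * key

/-- Differentiate `R_n = r_n + r_(n+1)`; the product identity, now used upward, removes `R_(n+1)`.
-/
theorem hasDerivAt_R {t : ℝ} (ht : 0 < t) (n : ℕ) :
    HasDerivAt (R n) ((R n t ^ 2 + (1 - 2 * r n t) * R n t - 4 * (-1) ^ n * t) / (2 * t)) t := by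
  have h1 : R n =ᶠ[nhds t] fun s => r n s + r (n + 1) s := by
    filter_upwards [lt_mem_nhds ht] with s hs using R_eq_r_add_r hs n
  refine (((hasDerivAt_r ht n).add (hasDerivAt_r_succ ht n)).congr_of_eventuallyEq h1).congr_deriv ?_
  have key := h_div_mul_R_mul_R ht n
  have hb := two_mul_h_succ_div ht n
  have hR := (R_pos ht n).ne'
  have hb' : h (n + 1) t / h n t = ((n + 1 : ℕ) + r (n + 1) t) / 2 := by linarith
  rw [hb'] at key
  have hr : r (n + 1) t = R n t - r n t := by rw [R_eq_r_add_r ht n]; ring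
  rw [hr] at key ⊢
  push_cast at key ⊢
  field_simp
  linear_combination -2 * key

/-! ### Second order equations -/

theorem hasDerivAt_deriv_R {t : ℝ} (ht : 0 < t) (n : ℕ) :
    HasDerivAt (deriv (R n))
      ((2 * R n t * deriv (R n) t - 2 * deriv (r n) t * R n t + (1 - 2 * r n t) * deriv (R n) t
        - 4 * (-1) ^ n) / (2 * t) - deriv (R n) t / t) t := by
  have hR := hasDerivAt_R ht n
  have hr := hasDerivAt_r ht n
  have hR0 := (R_pos ht n).ne'
  rw [hR.deriv, hr.deriv]
  have heq : deriv (R n) =ᶠ[nhds t] fun s =>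
      (R n s ^ 2 + (1 - 2 * r n s) * R n s - 4 * (-1) ^ n * s) / (2 * s) := by
    filter_upwards [lt_mem_nhds ht] with s hs using (hasDerivAt_R hs n).deriv
  have h1 := ((((hR.pow 2).add (((hr.const_mul 2).const_sub 1).mul hR)).sub
    ((hasDerivAt_id t).const_mul (4 * (-1 : ℝ) ^ n))).div ((hasDerivAt_id t).const_mul 2)
    (by simpa using ht.ne')).congr_of_eventuallyEq heq
  refine h1.congr_deriv ?_
  simp only [id, Pi.add_apply, Pi.sub_apply, Pi.mul_apply, Pi.pow_apply]
  field_simp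
  push_cast
  ring

theorem hasDerivAt_deriv_r {t : ℝ} (ht : 0 < t) (n : ℕ) :
    HasDerivAt (deriv (r n))
      (-(2 * (-1) ^ n * (deriv (r n) t * R n t - r n t * deriv (R n) t) / R n t ^ 2)
        - (deriv (r n) t * R n t + (n + r n t) * deriv (R n) t) / (2 * t)
        + (n + r n t) * R n t / (2 * t ^ 2)) t := by
  have hR := hasDerivAt_R ht n
  have hr := hasDerivAt_r ht n
  have hR0 := (R_pos ht n).ne'
  rw [hR.deriv, hr.deriv]
  have heq : deriv (r n) =ᶠ[nhds t] fun s =>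
      -(2 * (-1) ^ n * r n s / R n s) - (n + r n s) / (2 * s) * R n s := by
    filter_upwards [lt_mem_nhds ht] with s hs using (hasDerivAt_r hs n).deriv
  have h1 := ((((hr.const_mul (2 * (-1 : ℝ) ^ n)).div hR hR0).neg).sub
    (((hr.const_add (n : ℝ)).div ((hasDerivAt_id t).const_mul 2)
    (by simpa using ht.ne')).mul hR)).congr_of_eventuallyEq heq
  refine h1.congr_deriv ?_
  simp only [id, Pi.div_apply]
  field_simp
  ring

theorem R_second_order {t : ℝ} (ht : 0 < t) (n : ℕ) :
    deriv (deriv (R n)) t = (deriv (R n) t) ^ 2 / R n t - deriv (R n) t / t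
      + (2 * n + 1) * R n t ^ 2 / (4 * t ^ 2) - (-1) ^ n / t
      + R n t ^ 3 / (4 * t ^ 2) - 4 / R n t := by
  have hR0 := (R_pos ht n).ne'
  have he : ((-1 : ℝ) ^ n) ^ 2 = 1 := by rw [← pow_mul, mul_comm, pow_mul]; simp
  rw [(hasDerivAt_deriv_R ht n).deriv, (hasDerivAt_R ht n).deriv, (hasDerivAt_r ht n).deriv]
  generalize (-1 : ℝ) ^ n = e at he ⊢
  field_simp
  linear_combination (-64 * t ^ 2) * he

theorem r_second_order {t : ℝ} (ht : 0 < t) (n : ℕ) :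
    (2 * t ^ 2 * deriv (r n) t * deriv (deriv (r n)) t
        + 2 * t * r n t * (deriv (r n) t) ^ 2 - 8 * (-1) ^ n * t * r n t * deriv (r n) t
        + t * (deriv (r n) t) ^ 2 - 4 * (-1) ^ n * n * t * deriv (r n) t
        - 8 * (-1) ^ n * r n t ^ 3 - 8 * (-1) ^ n * n * r n t ^ 2) ^ 2
      = t * (t * (deriv (r n) t) ^ 2 - 4 * (-1) ^ n * r n t ^ 2 - 4 * (-1) ^ n * n * r n t)
        * (2 * t * deriv (deriv (r n)) t + 2 * r n t * deriv (r n) t + deriv (r n) t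
          - 8 * (-1) ^ n * r n t - 4 * (-1) ^ n * n) ^ 2 := by
  have hR0 := (R_pos ht n).ne'
  -- The equation for `r_n'` is the quadratic `(n + r) R^2 + 2 t r' R + 4 (-1)^n t r = 0` in `R`;
  -- completing the square gives this.
  have hdisc : t * (t * (deriv (r n) t) ^ 2 - 4 * (-1) ^ n * r n t ^ 2 - 4 * (-1) ^ n * n * r n t)
      = ((n + r n t) * R n t + t * deriv (r n) t) ^ 2 := by
    rw [(hasDerivAt_r ht n).deriv]
    field_simp
    ring
  -- A relation linear in the square root of the discriminant; squaring it eliminates `R`.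
  have hroot : 2 * t ^ 2 * deriv (r n) t * deriv (deriv (r n)) t
        + 2 * t * r n t * (deriv (r n) t) ^ 2 - 8 * (-1) ^ n * t * r n t * deriv (r n) t
        + t * (deriv (r n) t) ^ 2 - 4 * (-1) ^ n * n * t * deriv (r n) t
        - 8 * (-1) ^ n * r n t ^ 3 - 8 * (-1) ^ n * n * r n t ^ 2
      = ((n + r n t) * R n t + t * deriv (r n) t)
        * (2 * t * deriv (deriv (r n)) t + 2 * r n t * deriv (r n) t + deriv (r n) t
          - 8 * (-1) ^ n * r n t - 4 * (-1) ^ n * n) := by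
    rw [(hasDerivAt_deriv_r ht n).deriv, (hasDerivAt_R ht n).deriv, (hasDerivAt_r ht n).deriv]
    rcases neg_one_pow_eq_or ℝ n with he | he <;> rw [he] <;> field_simp <;> ring
  rw [hdisc, hroot, mul_pow]

/-! ### Convergence and regularity statements -/

theorem integrable_R_integrand {t : ℝ} (ht : 0 < t) (n : ℕ) :
    Integrable fun y : ℝ => 1 / y ^ 2 * (P t n).eval y ^ 2 * weight y t := by
  refine (integrable_mul_weight ht 2 (P t n ^ 2)).congr (.of_forall fun y => ?_)
  simp only [eval_pow, one_div, inv_pow]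
  ring

theorem integrable_r_integrand {t : ℝ} (ht : 0 < t) (m n : ℕ) :
    Integrable fun y : ℝ => 1 / y ^ 3 * (P t m).eval y * (P t n).eval y * weight y t := by
  refine (integrable_mul_weight ht 3 (P t m * P t n)).congr (.of_forall fun y => ?_)
  simp only [eval_mul, one_div, inv_pow]
  ring

theorem twiceDifferentiable_R (n : ℕ) : TwiceDifferentiable (R n) := fun _ ht =>
  ⟨(hasDerivAt_R ht n).differentiableAt, (hasDerivAt_deriv_R ht n).differentiableAt⟩

theorem twiceDifferentiable_r (n : ℕ) : TwiceDifferentiable (r n) := fun _ ht =>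
  ⟨(hasDerivAt_r ht n).differentiableAt, (hasDerivAt_deriv_r ht n).differentiableAt⟩

end SingularGaussian

end

open SingularGaussian in
theorem mainTheorem1 (n : ℕ) :
    -- the objects are well defined: the `P_n` are the monic orthogonal polynomials, and the
    -- integrals defining `R_n` and `r_n` converge
    (∀ t : ℝ, 0 < t →
      IsMonicOrthogonal t (P t) ∧
      MeasureTheory.Integrable (fun y : ℝ => 1 / y ^ 2 * (P t n).eval y ^ 2 * weight y t) ∧
      MeasureTheory.Integrable
        (fun y : ℝ => 1 / y ^ 3 * (P t n).eval y * (P t (n - 1)).eval y * weight y t)) ∧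
    -- `R_n` solves the Painlevé III' equation
    SolvesPIII' (2 * n + 1) (-4 * (-1) ^ n) 1 (-16) (R n) ∧
    -- the same equation written out
    (∀ t : ℝ, 0 < t →
      deriv (deriv (R n)) t = (deriv (R n) t) ^ 2 / R n t - deriv (R n) t / t
        + (2 * n + 1) * R n t ^ 2 / (4 * t ^ 2) - (-1) ^ n / t
        + R n t ^ 3 / (4 * t ^ 2) - 4 / R n t) ∧
    -- the second order equation for `r_n`
    TwiceDifferentiable (r n) ∧
    (∀ t : ℝ, 0 < t →
      (2 * t ^ 2 * deriv (r n) t * deriv (deriv (r n)) t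
        + 2 * t * r n t * (deriv (r n) t) ^ 2 - 8 * (-1) ^ n * t * r n t * deriv (r n) t
        + t * (deriv (r n) t) ^ 2 - 4 * (-1) ^ n * n * t * deriv (r n) t
        - 8 * (-1) ^ n * r n t ^ 3 - 8 * (-1) ^ n * n * r n t ^ 2) ^ 2
      = t * (t * (deriv (r n) t) ^ 2 - 4 * (-1) ^ n * r n t ^ 2 - 4 * (-1) ^ n * n * r n t)
        * (2 * t * deriv (deriv (r n)) t + 2 * r n t * deriv (r n) t + deriv (r n) t
          - 8 * (-1) ^ n * r n t - 4 * (-1) ^ n * n) ^ 2) ∧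
    -- the coupled first order system
    (∀ t : ℝ, 0 < t →
      deriv (r n) t = -(2 * (-1) ^ n * r n t / R n t) - (n + r n t) / (2 * t) * R n t ∧
      2 * t * deriv (R n) t = R n t ^ 2 + (1 - 2 * r n t) * R n t - 4 * (-1) ^ n * t) := by
  refine ⟨fun t ht => ⟨P_isMonicOrthogonal ht, integrable_R_integrand ht n,
    integrable_r_integrand ht n (n - 1)⟩, ⟨twiceDifferentiable_R n, fun t ht =>
    ⟨(R_pos ht n).ne', ?_⟩⟩, fun t ht => R_second_order ht n, twiceDifferentiable_r n,
    fun t ht => r_second_order ht n, fun t ht => ⟨(hasDerivAt_r ht n).deriv, ?_⟩⟩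
  · rw [R_second_order ht n]
    have hR0 := (R_pos ht n).ne'
    field_simp
    ring
  · rw [(hasDerivAt_R ht n).deriv]
    field_simp
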